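/- Let $\mathbb K$ be $\mathbb R$ or $\mathbb C$, let $X,Y$ be Banach spaces over $\mathbb K$ and let $m\ge 2$. For $k\ge 1$ and normed spaces $E,F$ over $\mathbb K$, let $\mathcal P({}^kE;F)$ be the space of continuous $k$-homogeneous polynomials $P:E\to F$ (that is, $P(x)=A(x,\dots,x)$ for some continuous $k$-linear $A$), with the norm $\|P\|=\sup_{\|x\|\le 1}\|P(x)\|$; write $\mathcal P({}^kE)=\mathcal P({}^kE;\mathbb K)$ and $\mathcal L(E;F)=\mathcal P({}^1E;F)$. The rank of $P$ is the dimension of the linear span of $P(E)$. For $n\in\mathbb N=\{1,2,\dots\}$ and $P\in\mathcal P({}^kE;F)$ put $$\tilde a_n(P)=\inf\{\|P-Q\| : Q\in\mathcal P({}^kE;F),\ \operatorname{rank}(Q)<n\},$$ $$\tilde d_n(P)=\inf\{\varepsilon>0 : P(\overline B_E)\subset N+\varepsilon\overline B_F \text{ for some linear subspace } N\subset F \text{ with } \dim N<n\},$$ $$\tilde c_n(P)=\tilde a_n(J_F P),$$ where $\overline B_E$ denotes the closed unit ball and $J_F:F\to\ell_\infty(\overline B_{F^*})$, $J_F y=(\varphi(y))_{\varphi\in\overline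 B_{F^*}}$, is the canonical metric injection. For a continuous linear operator $T$ write $d_n(T)=\tilde d_n(T)$ and $c_n(T)=\tilde c_n(T)$ (the case $k=1$); these are the Kolmogorov and Gelfand numbers. The adjoint of $P\in\mathcal P({}^mX;Y)$ is the continuous linear operator $P^*:Y^*\to\mathcal P({}^mX)$, $P^*(\varphi)(x)=\varphi(P(x))$. Then for every $P\in\mathcal P({}^mX;Y)$ and every $n\in\mathbb N$: (i) $c_n(P^*)\le\tilde d_n(P)$; (ii) $\tilde c_n(P)=d_n(P^*)$; (iii) $\tilde c_n(P)\le 2\sqrt n\,c_n(P^*)$. -/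

import Mathlib

open Metric
open scoped Pointwise ENNReal

noncomputable section

namespace PolySNum

/-- The space of all maps `P : X → Y` of the form `P x = A (x, …, x)` with `A` a continuous
`m`-linear mapping, as a space of functions. -/
def homPolySubmodule (𝕜 : Type*) [RCLike 𝕜] (m : ℕ) (X Y : Type*)
    [NormedAddCommGroup X] [NormedSpace 𝕜 X] [NormedAddCommGroup Y] [NormedSpace 𝕜 Y] :
    Submodule 𝕜 (X → Y) where
  carrier := {P | ∃ A : ContinuousMultilinearMap 𝕜 (fun _ : Fin m => X) Y,
    ∀ x, P x = A (fun _ => x)}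
  add_mem' := by
    rintro P Q ⟨A, hA⟩ ⟨B, hB⟩
    exact ⟨A + B, fun x => by simp [hA, hB]⟩
  zero_mem' := ⟨0, fun x => by simp⟩
  smul_mem' := by
    rintro c P ⟨A, hA⟩
    exact ⟨c • A, fun x => by simp [hA]⟩

/-- The space of continuous `m`-homogeneous polynomials from `X` to `Y`. It is a type of its own,
because it carries the sup norm over the unit ball and not the topology of pointwise
convergence. -/
def HomPoly (𝕜 : Type*) [RCLike 𝕜] (m : ℕ) (X Y : Type*)
    [NormedAddCommGroup X] [NormedSpace 𝕜 X] [NormedAddCommGroup Y] [NormedSpace 𝕜 Y] : Type _ :=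
  ↥(homPolySubmodule 𝕜 m X Y)

namespace HomPoly

variable {𝕜 : Type*} [RCLike 𝕜] {m : ℕ} {X Y Z : Type*}
  [NormedAddCommGroup X] [NormedSpace 𝕜 X] [NormedAddCommGroup Y] [NormedSpace 𝕜 Y]
  [NormedAddCommGroup Z] [NormedSpace 𝕜 Z]

instance instAddCommGroup : AddCommGroup (HomPoly 𝕜 m X Y) :=
  inferInstanceAs (AddCommGroup ↥(homPolySubmodule 𝕜 m X Y))

instance instModule : Module 𝕜 (HomPoly 𝕜 m X Y) :=
  inferInstanceAs (Module 𝕜 ↥(homPolySubmodule 𝕜 m X Y))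

instance instFunLike : FunLike (HomPoly 𝕜 m X Y) X Y where
  coe P := P.1
  coe_injective := fun _ _ h => Subtype.ext h

/-- The polynomial with a given underlying map. -/
def mk (P : X → Y) (h : ∃ A : ContinuousMultilinearMap 𝕜 (fun _ : Fin m => X) Y,
    ∀ x, P x = A (fun _ => x)) : HomPoly 𝕜 m X Y := ⟨P, h⟩

@[simp] theorem mk_apply (P : X → Y) (h : ∃ A : ContinuousMultilinearMap 𝕜 (fun _ : Fin m => X) Y,
    ∀ x, P x = A (fun _ => x)) (x : X) : mk P h x = P x := rfl

@[simp] theorem add_apply (P Q : HomPoly 𝕜 m X Y) (x : X) : (P + Q) x = P x + Q x := rfl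
@[simp] theorem sub_apply (P Q : HomPoly 𝕜 m X Y) (x : X) : (P - Q) x = P x - Q x := rfl
@[simp] theorem neg_apply (P : HomPoly 𝕜 m X Y) (x : X) : (-P) x = -P x := rfl
@[simp] theorem zero_apply (x : X) : (0 : HomPoly 𝕜 m X Y) x = 0 := rfl
@[simp] theorem smul_apply (c : 𝕜) (P : HomPoly 𝕜 m X Y) (x : X) : (c • P) x = c • P x := rfl

theorem exists_multilinear (P : HomPoly 𝕜 m X Y) :
    ∃ A : ContinuousMultilinearMap 𝕜 (fun _ : Fin m => X) Y, ∀ x, P x = A (fun _ => x) := P.2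

theorem map_smul_pow (P : HomPoly 𝕜 m X Y) (c : 𝕜) (x : X) : P (c • x) = c ^ m • P x := by
  obtain ⟨A, hA⟩ := P.exists_multilinear
  rw [hA, hA]
  have := A.map_smul_univ (fun _ => c) (fun _ => x)
  simpa using this

/-- `‖P‖ = sup {‖P x‖ : ‖x‖ ≤ 1}`. -/
instance instNorm : Norm (HomPoly 𝕜 m X Y) where
  norm P := ⨆ x : closedBall (0 : X) 1, ‖P x‖

theorem norm_def (P : HomPoly 𝕜 m X Y) : ‖P‖ = ⨆ x : closedBall (0 : X) 1, ‖P x‖ := rfl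

theorem bddAbove_range (P : HomPoly 𝕜 m X Y) :
    BddAbove (Set.range fun x : closedBall (0 : X) 1 => ‖P x‖) := by
  obtain ⟨A, hA⟩ := P.exists_multilinear
  refine ⟨‖A‖, ?_⟩
  rintro _ ⟨x, rfl⟩
  have hx : ‖(x : X)‖ ≤ 1 := mem_closedBall_zero_iff.mp x.2
  simp only [hA]
  refine (A.le_opNorm _).trans ?_
  simp only [Finset.prod_const, Finset.card_univ, Fintype.card_fin]
  exact mul_le_of_le_one_right (norm_nonneg _) (pow_le_one₀ (norm_nonneg _) hx)

theorem norm_apply_le (P : HomPoly 𝕜 m X Y) {x : X} (hx : ‖x‖ ≤ 1) : ‖P x‖ ≤ ‖P‖ :=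
  le_ciSup (bddAbove_range P) ⟨x, mem_closedBall_zero_iff.mpr hx⟩

theorem norm_le_of {P : HomPoly 𝕜 m X Y} {r : ℝ} (h : ∀ x : X, ‖x‖ ≤ 1 → ‖P x‖ ≤ r) :
    ‖P‖ ≤ r :=
  haveI : Nonempty (closedBall (0 : X) 1) := ⟨⟨0, by simp⟩⟩
  ciSup_le fun x => h x (mem_closedBall_zero_iff.mp x.2)

theorem normCore : NormedSpace.Core 𝕜 (HomPoly 𝕜 m X Y) where
  norm_nonneg P := Real.iSup_nonneg fun _ => norm_nonneg _
  norm_smul c P := by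
    rw [norm_def, norm_def, Real.mul_iSup_of_nonneg (norm_nonneg c)]
    simp [norm_smul]
  norm_triangle P Q := norm_le_of fun x hx =>
    (norm_add_le _ _).trans (add_le_add (P.norm_apply_le hx) (Q.norm_apply_le hx))
  norm_eq_zero_iff P := by
    constructor
    · intro h
      refine DFunLike.ext _ _ fun x => ?_
      have hr : ∀ y : X, ‖y‖ ≤ 1 → P y = 0 := fun y hy => by
        have := P.norm_apply_le hy
        rw [h] at this
        exact norm_le_zero_iff.mp this
      have h0 : (((‖x‖ + 1 : ℝ)) : 𝕜) ≠ 0 := by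
        exact_mod_cast (by positivity : (‖x‖ + 1 : ℝ) ≠ 0)
      have hx : x = ((‖x‖ + 1 : ℝ) : 𝕜) • ((((‖x‖ + 1 : ℝ) : 𝕜))⁻¹ • x) := by
        rw [smul_smul, mul_inv_cancel₀ h0, one_smul]
      rw [hx, map_smul_pow, hr, smul_zero, zero_apply]
      rw [norm_smul, norm_inv, RCLike.norm_ofReal, abs_of_pos (by positivity), inv_mul_le_iff₀
        (by positivity)]
      linarith
    · rintro rfl
      simp [norm_def]

instance instNormedAddCommGroup : NormedAddCommGroup (HomPoly 𝕜 m X Y) :=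
  NormedAddCommGroup.ofCore (normCore (𝕜 := 𝕜))

instance instNormedSpace : NormedSpace 𝕜 (HomPoly 𝕜 m X Y) :=
  NormedSpace.ofCore normCore

/-- A continuous linear operator as a continuous `1`-homogeneous polynomial. -/
def ofCLM (T : X →L[𝕜] Y) : HomPoly 𝕜 1 X Y :=
  mk T ⟨ContinuousMultilinearMap.ofSubsingleton 𝕜 X Y (0 : Fin 1) T, fun _ => rfl⟩

/-- The composition `T ∘ P` with a continuous linear operator `T`. -/
def postcomp (T : Y →L[𝕜] Z) (P : HomPoly 𝕜 m X Y) : HomPoly 𝕜 m X Z :=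
  mk (fun x => T (P x)) <| by
    obtain ⟨A, hA⟩ := P.exists_multilinear
    exact ⟨T.compContinuousMultilinearMap A, fun x => by simp [hA]⟩

/-- The adjoint `P* : Y* → 𝒫(ᵐX)`, `P* φ = φ ∘ P`. -/
def adjoint (P : HomPoly 𝕜 m X Y) : StrongDual 𝕜 Y →L[𝕜] HomPoly 𝕜 m X 𝕜 :=
  LinearMap.mkContinuous
    { toFun := fun φ => postcomp φ P
      map_add' := fun _ _ => rfl
      map_smul' := fun _ _ => rfl } ‖P‖ <| fun φ => norm_le_of fun x hx => by
    refine (φ.le_opNorm _).trans ?_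
    rw [mul_comm]
    exact mul_le_mul_of_nonneg_right (P.norm_apply_le hx) (norm_nonneg _)

@[simp] theorem ofCLM_apply (T : X →L[𝕜] Y) (x : X) : ofCLM T x = T x := rfl

@[simp] theorem postcomp_apply (T : Y →L[𝕜] Z) (P : HomPoly 𝕜 m X Y) (x : X) :
    postcomp T P x = T (P x) := rfl

@[simp] theorem adjoint_apply (P : HomPoly 𝕜 m X Y) (φ : StrongDual 𝕜 Y) (x : X) :
    adjoint P φ x = φ (P x) := rfl

/-- The rank of `P`: the dimension (a cardinal) of the linear span of `P(X)`. -/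
def rank (P : HomPoly 𝕜 m X Y) : Cardinal :=
  Module.rank 𝕜 (Submodule.span 𝕜 (Set.range P))

/-- The `n`-th approximation number `inf {‖P - Q‖ : rank Q < n}` (for `n ≥ 1`). -/
def approxNumber (n : ℕ) (P : HomPoly 𝕜 m X Y) : ℝ :=
  sInf {r : ℝ | ∃ Q : HomPoly 𝕜 m X Y, Q.rank < (n : Cardinal) ∧ r = ‖P - Q‖}

/-- The `n`-th Kolmogorov number (for `n ≥ 1`): the infimum of the `ε > 0` such that the image of
the closed unit ball lies in `N + ε B_Y` for some subspace `N` of `Y` with `dim N < n`. -/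
def kolmogorovNumber (n : ℕ) (P : HomPoly 𝕜 m X Y) : ℝ :=
  sInf {ε : ℝ | 0 < ε ∧ ∃ N : Submodule 𝕜 Y, Module.rank 𝕜 N < (n : Cardinal) ∧
    P '' closedBall (0 : X) 1 ⊆ (N : Set Y) + closedBall (0 : Y) ε}

end HomPoly

section Injection

variable (𝕜 : Type*) [RCLike 𝕜] (Y : Type*) [NormedAddCommGroup Y] [NormedSpace 𝕜 Y]

theorem memℓp_eval (y : Y) :
    Memℓp (fun φ : closedBall (0 : StrongDual 𝕜 Y) 1 => (φ : StrongDual 𝕜 Y) y) ∞ := by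
  refine memℓp_infty ⟨‖y‖, ?_⟩
  rintro _ ⟨φ, rfl⟩
  have hφ : ‖(φ : StrongDual 𝕜 Y)‖ ≤ 1 := mem_closedBall_zero_iff.mp φ.2
  exact (φ : StrongDual 𝕜 Y).le_of_opNorm_le hφ y |>.trans (by simp)

/-- The canonical metric injection `J_Y : Y → ℓ_∞(B)`, `J_Y y = (φ y)_φ`, where `B` is the closed
unit ball of `Y*`. -/
def metricInjection :
    Y →ₗᵢ[𝕜] lp (fun _ : closedBall (0 : StrongDual 𝕜 Y) 1 => 𝕜) ∞ where
  toFun y := ⟨fun φ => (φ : StrongDual 𝕜 Y) y, memℓp_eval 𝕜 Y y⟩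
  map_add' y z := by
    ext φ
    exact map_add (φ : StrongDual 𝕜 Y) y z
  map_smul' c y := by
    ext φ
    exact map_smul (φ : StrongDual 𝕜 Y) c y
  norm_map' y := by
    refine le_antisymm ?_ ?_
    · refine lp.norm_le_of_forall_le (norm_nonneg y) fun φ => ?_
      have hφ : ‖(φ : StrongDual 𝕜 Y)‖ ≤ 1 := mem_closedBall_zero_iff.mp φ.2
      exact (φ : StrongDual 𝕜 Y).le_of_opNorm_le hφ y |>.trans (by simp)
    · obtain ⟨g, hg, hgy⟩ := exists_dual_vector'' 𝕜 y
      have := lp.norm_apply_le_norm (p := ∞) (by simp)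
        (⟨fun φ => (φ : StrongDual 𝕜 Y) y, memℓp_eval 𝕜 Y y⟩ :
          lp (fun _ : closedBall (0 : StrongDual 𝕜 Y) 1 => 𝕜) ∞) ⟨g, mem_closedBall_zero_iff.mpr hg⟩
      simpa [hgy] using this

end Injection

/-- The `n`-th Gelfand number (for `n ≥ 1`): the `n`-th approximation number of `J_Y ∘ P`. -/
def HomPoly.gelfandNumber {𝕜 : Type*} [RCLike 𝕜] {m : ℕ} {X Y : Type*}
    [NormedAddCommGroup X] [NormedSpace 𝕜 X] [NormedAddCommGroup Y] [NormedSpace 𝕜 Y]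
    (n : ℕ) (P : HomPoly 𝕜 m X Y) : ℝ :=
  HomPoly.approxNumber n (HomPoly.postcomp (metricInjection 𝕜 Y).toContinuousLinearMap P)

end PolySNum

end

open scoped Matrix

namespace PolySNum

/-! (i) If `P` maps the unit ball into `N + ε B`, then `‖P* φ‖ ≤ ε ‖φ‖` for every `φ` vanishing on
`N`, and these `φ` form a subspace of codimension `dim N`. By Hahn–Banach, such a bound controls a
Gelfand number (`gelfandNumber_ofCLM_le`).

(ii) The `φ`-th coordinate of `J P` is `P* φ`. Hence approximating `J P` by a polynomial of rank `<
n` amounts to approximating all `P* φ`, `‖φ‖ ≤ 1`, from one subspace of dimension `< n`.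

(iii) By (ii) it suffices that `d_n(T) ≤ 2√n c_n(T)` for operators. Let `T` be bounded by `r` on the
kernel of a surjection `q` onto `𝕜^k`, `k < n`. A lift `S` of `q` with `‖S (q x)‖ ≤ √(k+1)` on the
unit ball makes `T S q` an approximation of `T` with error at most `(1 + √n) r`.

The lift (`exists_lift_norm_le`) comes from a Kiefer–Wolfowitz argument. Averages `A` of matrices
`q(x) q(x)*` over the unit ball carry a natural `L` with `q L = A` and `‖L w‖² ≤ w* A w`;
`IsBoundedLift` keeps just these two properties. If `|det A|` is nearly maximal, mixing in one more
`q(x) q(x)*` cannot increase it much, which forces `Re q(x)* A⁻¹ q(x) ≤ k + 1`. Then `S = L A⁻¹`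
works. Relaxing the optimal `k` to `k + 1` lets a near-maximiser suffice, without compactness. -/

theorem rank_lt_natCast_iff {K V : Type*} [Field K] [AddCommGroup V] [Module K V] {n : ℕ} :
    Module.rank K V < (n : Cardinal) ↔ Module.Finite K V ∧ Module.finrank K V < n := by
  constructor
  · intro h
    have hf : Module.Finite K V :=
      Module.rank_lt_aleph0_iff.mp (h.trans (Cardinal.natCast_lt_aleph0))
    exact ⟨hf, Module.finrank_lt_of_rank_lt h⟩
  · rintro ⟨hf, h⟩
    rw [← Module.finrank_eq_rank K V]
    exact_mod_cast h

/-- A linear map that vanishes wherever `f` does factors through the range of `f`. -/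
theorem exists_comp_eq_of_ker_le {K V V₂ V₃ : Type*} [Field K] [AddCommGroup V] [Module K V]
    [AddCommGroup V₂] [Module K V₂] [AddCommGroup V₃] [Module K V₃]
    (f : V →ₗ[K] V₂) (g : V →ₗ[K] V₃) (h : ∀ x, f x = 0 → g x = 0) :
    ∃ l : V₂ →ₗ[K] V₃, l ∘ₗ f = g := by
  obtain ⟨s, hs⟩ := f.rangeRestrict.exists_rightInverse_of_surjective f.range_rangeRestrict
  obtain ⟨p, hp⟩ := (LinearMap.range f).subtype.exists_leftInverse_of_injective
    (LinearMap.range f).ker_subtype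
  refine ⟨g ∘ₗ s ∘ₗ p, ?_⟩
  ext x
  have h1 : p (f x) = f.rangeRestrict x := LinearMap.congr_fun hp (f.rangeRestrict x)
  have h2 : f (s (f.rangeRestrict x)) = f x :=
    congrArg Subtype.val (LinearMap.congr_fun hs (f.rangeRestrict x))
  have h3 := h (s (f.rangeRestrict x) - x) (by rw [map_sub, h2, sub_self])
  rw [map_sub, sub_eq_zero] at h3
  simp [h1, h3]

/-- Since `g` factors through `f`, its range is contained in a linear image of `V₂`. -/
theorem rank_range_lt_of_ker_le {K V V₂ V₃ : Type*} [Field K] [AddCommGroup V] [Module K V]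
    [AddCommGroup V₂] [Module K V₂] [Module.Finite K V₂] [AddCommGroup V₃] [Module K V₃]
    {n : ℕ} (f : V →ₗ[K] V₂) (g : V →ₗ[K] V₃) (h : ∀ x, f x = 0 → g x = 0)
    (hn : Module.finrank K V₂ < n) :
    Module.rank K (LinearMap.range g) < (n : Cardinal) := by
  obtain ⟨l, rfl⟩ := exists_comp_eq_of_ker_le f g h
  have hle := LinearMap.range_comp_le_range f l
  refine rank_lt_natCast_iff.mpr ⟨Submodule.finiteDimensional_of_le hle, ?_⟩
  exact ((Submodule.finrank_mono hle).trans (LinearMap.finrank_range_le l)).trans_lt hn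

/-! ### Approximation, Kolmogorov and Gelfand numbers, and their duality. -/

namespace HomPoly

variable {𝕜 : Type*} [RCLike 𝕜] {m : ℕ} {X Y Z : Type*}
  [NormedAddCommGroup X] [NormedSpace 𝕜 X] [NormedAddCommGroup Y] [NormedSpace 𝕜 Y]
  [NormedAddCommGroup Z] [NormedSpace 𝕜 Z]

theorem exists_eq_ofCLM (Q : HomPoly 𝕜 1 X Y) : ∃ T : X →L[𝕜] Y, Q = ofCLM T := by
  obtain ⟨A, hA⟩ := Q.exists_multilinear
  refine ⟨(ContinuousMultilinearMap.ofSubsingleton 𝕜 X Y (0 : Fin 1)).symm A,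
    DFunLike.ext _ _ fun x => ?_⟩
  rw [hA, ofCLM_apply]
  simp

theorem rank_ofCLM (T : X →L[𝕜] Y) :
    (ofCLM T).rank = Module.rank 𝕜 (LinearMap.range (T : X →ₗ[𝕜] Y)) := by
  have : Submodule.span 𝕜 (Set.range (ofCLM T)) = LinearMap.range (T : X →ₗ[𝕜] Y) := by
    rw [show Set.range (ofCLM T) = (LinearMap.range (T : X →ₗ[𝕜] Y) : Set Y) from rfl,
      Submodule.span_eq]
  rw [rank, this]

theorem rank_zero : (0 : HomPoly 𝕜 m X Y).rank = 0 := by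
  have : Submodule.span 𝕜 (Set.range (0 : HomPoly 𝕜 m X Y)) = ⊥ := by
    rw [Submodule.span_eq_bot]
    rintro _ ⟨x, rfl⟩
    rfl
  rw [rank, this, rank_bot]

theorem sum_apply {ι : Type*} (s : Finset ι) (P : ι → HomPoly 𝕜 m X Y) (x : X) :
    (∑ i ∈ s, P i) x = ∑ i ∈ s, P i x := by
  classical
  induction s using Finset.induction_on with
  | empty => simp
  | insert a s ha ih => rw [Finset.sum_insert ha, Finset.sum_insert ha, add_apply, ih]

theorem approxNumber_le {n : ℕ} {P Q : HomPoly 𝕜 m X Y} (hQ : Q.rank < (n : Cardinal)) :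
    P.approxNumber n ≤ ‖P - Q‖ :=
  csInf_le ⟨0, by rintro _ ⟨R, -, rfl⟩; exact norm_nonneg _⟩ ⟨Q, hQ, rfl⟩

theorem le_approxNumber {n : ℕ} (hn : 1 ≤ n) {P : HomPoly 𝕜 m X Y} {a : ℝ}
    (h : ∀ Q : HomPoly 𝕜 m X Y, Q.rank < (n : Cardinal) → a ≤ ‖P - Q‖) :
    a ≤ P.approxNumber n := by
  -- For `n = 0` the set would be empty and its `sInf` the default value `0`; `n ≥ 1` admits the
  -- zero polynomial.
  refine le_csInf ⟨_, 0, ?_, rfl⟩ ?_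
  · rw [rank_zero]
    exact_mod_cast hn
  · rintro _ ⟨Q, hQ, rfl⟩
    exact h Q hQ

theorem kolmogorovNumber_le {n : ℕ} {P : HomPoly 𝕜 m X Y} {N : Submodule 𝕜 Y} {r : ℝ}
    (hr : 0 ≤ r) (hN : Module.rank 𝕜 N < (n : Cardinal))
    (h : ∀ x : X, ‖x‖ ≤ 1 → ∃ y ∈ N, ‖P x - y‖ ≤ r) : P.kolmogorovNumber n ≤ r := by
  -- The slack `δ` covers `r = 0`, since admissible `ε` are strictly positive.
  refine le_of_forall_pos_le_add fun δ hδ => csInf_le ⟨0, fun ε hε => hε.1.le⟩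
    ⟨by positivity, N, hN, ?_⟩
  rintro _ ⟨x, hx, rfl⟩
  obtain ⟨y, hy, hxy⟩ := h x (mem_closedBall_zero_iff.mp hx)
  exact ⟨y, hy, P x - y, mem_closedBall_zero_iff.mpr (by linarith), add_sub_cancel _ _⟩

theorem le_kolmogorovNumber {n : ℕ} (hn : 1 ≤ n) {P : HomPoly 𝕜 m X Y} {a : ℝ}
    (h : ∀ (ε : ℝ) (N : Submodule 𝕜 Y), 0 < ε → Module.rank 𝕜 N < (n : Cardinal) →
      (∀ x : X, ‖x‖ ≤ 1 → ∃ y ∈ N, ‖P x - y‖ ≤ ε) → a ≤ ε) :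
    a ≤ P.kolmogorovNumber n := by
  refine le_csInf ⟨‖P‖ + 1, by positivity, ⊥, ?_, ?_⟩ ?_
  · rw [rank_bot]
    exact_mod_cast hn
  · rintro _ ⟨x, hx, rfl⟩
    have := P.norm_apply_le (mem_closedBall_zero_iff.mp hx)
    exact ⟨0, Submodule.zero_mem _, P x, mem_closedBall_zero_iff.mpr (by linarith), zero_add _⟩
  · rintro ε ⟨hε, N, hN, hsub⟩
    refine h ε N hε hN fun x hx => ?_
    obtain ⟨y, hy, z, hz, hyz⟩ := hsub ⟨x, mem_closedBall_zero_iff.mpr hx, rfl⟩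
    refine ⟨y, hy, ?_⟩
    rw [← hyz]
    simpa using hz

/-- An operator whose restriction to a subspace of codimension less than `n` is bounded by `r` has
`n`-th Gelfand number at most `r`. -/
theorem gelfandNumber_ofCLM_le {V : Type*} [AddCommGroup V] [Module 𝕜 V] [Module.Finite 𝕜 V]
    {n : ℕ} (T : X →L[𝕜] Y) (f : X →ₗ[𝕜] V) (hn : Module.finrank 𝕜 V < n) {r : ℝ} (hr : 0 ≤ r)
    (h : ∀ x, f x = 0 → ‖T x‖ ≤ r * ‖x‖) : (ofCLM T).gelfandNumber n ≤ r := by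
  -- Each functional `ψ ∘ T` restricted to `ker f` is extended separately; an `ℓ_∞` target requires
  -- only a uniform bound on the extensions.
  have hext : ∀ ψ : closedBall (0 : StrongDual 𝕜 Y) 1, ∃ g : StrongDual 𝕜 X,
      (∀ x, f x = 0 → g x = (ψ : StrongDual 𝕜 Y) (T x)) ∧ ‖g‖ ≤ r := by
    intro ψ
    have hψ : ‖(ψ : StrongDual 𝕜 Y)‖ ≤ 1 := mem_closedBall_zero_iff.mp ψ.2
    obtain ⟨g, hg, hgn⟩ := exists_extension_norm_eq (LinearMap.ker f)
      (((ψ : StrongDual 𝕜 Y).comp T).comp (LinearMap.ker f).subtypeL)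
    refine ⟨g, fun x hx => hg ⟨x, hx⟩, ?_⟩
    rw [hgn]
    refine ContinuousLinearMap.opNorm_le_bound _ hr fun x => ?_
    exact ((ψ : StrongDual 𝕜 Y).le_of_opNorm_le hψ _).trans (by simpa using h x x.2)
  choose g hg hgr using hext
  have hgx : ∀ x ψ, ‖g ψ x‖ ≤ r * ‖x‖ := fun x ψ => (g ψ).le_of_opNorm_le (hgr ψ) x
  let G : X →L[𝕜] lp (fun _ : closedBall (0 : StrongDual 𝕜 Y) 1 => 𝕜) ∞ :=
    LinearMap.mkContinuous
      { toFun := fun x => ⟨fun ψ => g ψ x,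
          memℓp_infty ⟨r * ‖x‖, by rintro _ ⟨ψ, rfl⟩; exact hgx x ψ⟩⟩
        map_add' := fun x y => by ext ψ; exact map_add (g ψ) x y
        map_smul' := fun c x => by ext ψ; exact map_smul (g ψ) c x } r
      fun x => lp.norm_le_of_forall_le (by positivity) fun ψ => hgx x ψ
  set J := (metricInjection 𝕜 Y).toContinuousLinearMap
  have hQ : (ofCLM (J.comp T - G)).rank < (n : Cardinal) := by
    rw [rank_ofCLM]
    refine rank_range_lt_of_ker_le f _ (fun x hx => ?_) hn
    ext ψ
    exact sub_eq_zero.mpr (hg ψ x hx).symm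
  refine (approxNumber_le hQ).trans (norm_le_of fun x hx => ?_)
  have : (postcomp J (ofCLM T) - ofCLM (J.comp T - G)) x = G x :=
    sub_sub_cancel (J (T x)) (G x)
  rw [this]
  refine lp.norm_le_of_forall_le hr fun ψ => (hgx x ψ).trans (mul_le_of_le_one_right hr hx)

theorem gelfandNumber_adjoint_le {n : ℕ} (hn : 1 ≤ n) (P : HomPoly 𝕜 m X Y) :
    (ofCLM P.adjoint).gelfandNumber n ≤ P.kolmogorovNumber n := by
  refine le_kolmogorovNumber hn fun ε N hε hN hP => ?_
  obtain ⟨hfin, hlt⟩ := rank_lt_natCast_iff.mp hN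
  -- Restriction to `N`; its kernel is the annihilator of `N`.
  let f : StrongDual 𝕜 Y →ₗ[𝕜] Module.Dual 𝕜 N :=
    N.subtype.dualMap ∘ₗ ContinuousLinearMap.coeLM 𝕜
  refine gelfandNumber_ofCLM_le P.adjoint f (by rwa [Subspace.dual_finrank_eq]) hε.le
    fun φ hφ => norm_le_of fun x hx => ?_
  obtain ⟨y, hy, hxy⟩ := hP x hx
  have hφy : φ y = 0 := LinearMap.congr_fun hφ ⟨y, hy⟩
  have : P.adjoint φ x = φ (P x - y) := by rw [map_sub, hφy, sub_zero, adjoint_apply]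
  rw [this, mul_comm]
  exact (φ.le_opNorm _).trans (mul_le_mul_of_nonneg_left hxy (norm_nonneg _))

/-- The approximants of the `P* φ` become the coordinates of one polynomial into `ℓ_∞`. They may be
chosen arbitrarily, without linearity in `φ`; expanding them in a basis of `N` bounds the rank by
`dim N`. -/
theorem gelfandNumber_le_kolmogorovNumber_adjoint {n : ℕ} (hn : 1 ≤ n) (P : HomPoly 𝕜 m X Y) :
    P.gelfandNumber n ≤ (ofCLM P.adjoint).kolmogorovNumber n := by
  refine le_kolmogorovNumber hn fun ε N hε hN hP => ?_
  obtain ⟨hfin, hlt⟩ := rank_lt_natCast_iff.mp hN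
  have hex : ∀ φ : closedBall (0 : StrongDual 𝕜 Y) 1, ∃ ψ : N,
      ‖P.adjoint φ - ψ‖ ≤ ε := fun φ => by
    obtain ⟨y, hy, h⟩ := hP φ (mem_closedBall_zero_iff.mp φ.2)
    exact ⟨⟨y, hy⟩, h⟩
  choose ψ hψ using hex
  -- Uniform boundedness puts the coefficient families `c i` in `ℓ_∞`.
  have hψn : ∀ φ, ‖ψ φ‖ ≤ ‖P.adjoint‖ + ε := fun φ => by
    have h1 : ‖P.adjoint φ‖ ≤ ‖P.adjoint‖ := by
      simpa using P.adjoint.le_opNorm_of_le (mem_closedBall_zero_iff.mp φ.2)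
    have h2 := norm_sub_norm_le (ψ φ : HomPoly 𝕜 m X 𝕜) (P.adjoint φ)
    rw [norm_sub_rev] at h2
    have h3 : ‖ψ φ‖ = ‖(ψ φ : HomPoly 𝕜 m X 𝕜)‖ := rfl
    linarith [hψ φ]
  let b := Module.finBasis 𝕜 N
  let c : Fin (Module.finrank 𝕜 N) → lp (fun _ : closedBall (0 : StrongDual 𝕜 Y) 1 => 𝕜) ∞ :=
    fun i => ⟨fun φ => b.coord i (ψ φ), memℓp_infty
      ⟨‖(b.coord i).toContinuousLinearMap‖ * (‖P.adjoint‖ + ε), by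
        rintro _ ⟨φ, rfl⟩
        exact (b.coord i).toContinuousLinearMap.le_opNorm_of_le (hψn φ)⟩⟩
  let Q : HomPoly 𝕜 m X (lp (fun _ : closedBall (0 : StrongDual 𝕜 Y) 1 => 𝕜) ∞) :=
    ∑ i, postcomp (ContinuousLinearMap.toSpanSingleton 𝕜 (c i)) (b i : HomPoly 𝕜 m X 𝕜)
  have hQx : ∀ x, Q x = ∑ i, (b i : HomPoly 𝕜 m X 𝕜) x • c i := fun x => by
    rw [sum_apply]
    rfl
  have hQ : Q.rank < (n : Cardinal) := by
    have hle : Submodule.span 𝕜 (Set.range Q) ≤ Submodule.span 𝕜 (Set.range c) := by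
      rw [Submodule.span_le]
      rintro _ ⟨x, rfl⟩
      rw [hQx]
      exact Submodule.sum_mem _ fun i _ =>
        Submodule.smul_mem _ _ (Submodule.subset_span ⟨i, rfl⟩)
    have : FiniteDimensional 𝕜 (Submodule.span 𝕜 (Set.range c)) :=
      FiniteDimensional.span_of_finite 𝕜 (Set.finite_range c)
    refine rank_lt_natCast_iff.mpr ⟨Submodule.finiteDimensional_of_le hle, ?_⟩
    refine ((Submodule.finrank_mono hle).trans (finrank_range_le_card c)).trans_lt ?_
    simpa using hlt
  refine (approxNumber_le hQ).trans (norm_le_of fun x hx => ?_)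
  refine lp.norm_le_of_forall_le hε.le fun φ => ?_
  have hsum : (ψ φ : HomPoly 𝕜 m X 𝕜) x = (Q x) φ := by
    have h1 : (ψ φ : HomPoly 𝕜 m X 𝕜) =
        ∑ i, b.coord i (ψ φ) • (b i : HomPoly 𝕜 m X 𝕜) :=
      (congrArg N.subtype (b.sum_repr (ψ φ)).symm).trans (by rw [map_sum]; rfl)
    rw [h1, sum_apply, hQx, lp.coeFn_sum, Finset.sum_apply]
    exact Finset.sum_congr rfl fun i _ => mul_comm _ _
  refine le_trans (le_of_eq ?_) ((norm_apply_le _ hx).trans (hψ φ))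
  rw [sub_apply (P.adjoint φ), hsum]
  rfl

/-- The subspace is the range of `Q*`, of dimension at most the rank of `Q`; `P* φ` is approximated
by `Q*` applied to evaluation at `φ`. -/
theorem kolmogorovNumber_adjoint_le_gelfandNumber {n : ℕ} (hn : 1 ≤ n) (P : HomPoly 𝕜 m X Y) :
    (ofCLM P.adjoint).kolmogorovNumber n ≤ P.gelfandNumber n := by
  refine le_approxNumber hn fun Q hQ => ?_
  obtain ⟨hfin, hlt⟩ := rank_lt_natCast_iff.mp hQ
  set W := Submodule.span 𝕜 (Set.range Q)
  let f : StrongDual 𝕜 (lp (fun _ : closedBall (0 : StrongDual 𝕜 Y) 1 => 𝕜) ∞) →ₗ[𝕜]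
      Module.Dual 𝕜 W := W.subtype.dualMap ∘ₗ ContinuousLinearMap.coeLM 𝕜
  refine kolmogorovNumber_le (norm_nonneg _)
    (rank_range_lt_of_ker_le f (Q.adjoint : _ →ₗ[𝕜] _) (fun Λ hΛ => ?_)
      (by rwa [Subspace.dual_finrank_eq])) fun φ hφ => ?_
  · refine DFunLike.ext _ _ fun x => ?_
    exact LinearMap.congr_fun hΛ ⟨Q x, Submodule.subset_span ⟨x, rfl⟩⟩
  · let i : closedBall (0 : StrongDual 𝕜 Y) 1 := ⟨φ, mem_closedBall_zero_iff.mpr hφ⟩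
    refine ⟨_, ⟨lp.evalCLM 𝕜 (fun _ : closedBall (0 : StrongDual 𝕜 Y) 1 => 𝕜) ∞ i, rfl⟩,
      norm_le_of fun x hx => ?_⟩
    refine le_trans ?_ (norm_apply_le _ hx)
    exact lp.norm_apply_le_norm (p := ∞) (by simp)
      ((postcomp (metricInjection 𝕜 Y).toContinuousLinearMap P - Q) x) i

end HomPoly

/-! ### Near-maximal determinants and lifts of small norm. -/

theorem det_add_vecMulVec {R : Type*} [CommRing R] {k : ℕ} {A : Matrix (Fin k) (Fin k) R}
    (hA : IsUnit A.det) (u v : Fin k → R) :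
    (A + Matrix.vecMulVec u v).det = A.det * (1 + v ⬝ᵥ A⁻¹ *ᵥ u) := by
  rw [Matrix.vecMulVec_eq Unit, Matrix.det_add_replicateCol_mul_replicateRow hA]
  congr 1
  rw [Matrix.mul_assoc, ← Matrix.replicateCol_mulVec, Matrix.det_unique, Matrix.add_apply,
    Matrix.one_apply_eq, Matrix.replicateRow_mul_replicateCol_apply]

/-- Here `kt ≤ 1`, so `exp (kt) ≤ 1 + kt + (kt)²`, and `(kt)² < t`. This makes a rank-one update
with weight `t` strictly profitable for the determinant. -/
theorem one_add_pow_lt {k : ℕ} {t : ℝ} (ht : t = 1 / ((k : ℝ) + 1) ^ 2) :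
    (1 + t) ^ k < 1 + (k + 1) * t := by
  have hk : (0 : ℝ) ≤ k := k.cast_nonneg
  have hpos : 0 < t := by rw [ht]; positivity
  have hmul : t * ((k : ℝ) + 1) ^ 2 = 1 := by rw [ht]; field_simp
  have hkt : k * t ≤ 1 := by nlinarith
  have h1 : (1 + t) ^ k ≤ Real.exp (k * t) := by
    rw [Real.exp_nat_mul]
    exact pow_le_pow_left₀ (by positivity) (by linarith [Real.add_one_le_exp t]) k
  have h0 : 0 ≤ k * t := by positivity
  have h2 := Real.abs_exp_sub_one_sub_id_le (x := k * t) (by rwa [abs_of_nonneg h0])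
  have h3 := (abs_le.mp h2).2
  have h4 : (k * t) ^ 2 < t := by nlinarith
  linarith

section Projection

variable {𝕜 : Type*} [RCLike 𝕜] {E : Type*} [NormedAddCommGroup E] [NormedSpace 𝕜 E] {k : ℕ}

/-- `A = q ∘ L` is a matrix, and the lift `L` of `A` along `q` is bounded by the square root of the
quadratic form of `A`. -/
structure IsBoundedLift (q : E →L[𝕜] (Fin k → 𝕜)) (A : Matrix (Fin k) (Fin k) 𝕜)
    (L : (Fin k → 𝕜) →ₗ[𝕜] E) : Prop where
  apply_lift : ∀ w, q (L w) = A *ᵥ w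
  norm_sq_le : ∀ w, ‖L w‖ ^ 2 ≤ RCLike.re (star w ⬝ᵥ A *ᵥ w)

namespace IsBoundedLift

variable {q : E →L[𝕜] (Fin k → 𝕜)} {A : Matrix (Fin k) (Fin k) 𝕜} {L : (Fin k → 𝕜) →ₗ[𝕜] E}

/-- As `A w = q (L w)`, the quadratic form is at most linear in `‖L w‖`, so one factor `‖L w‖`
cancels. This a priori bound makes the determinants bounded. -/
theorem norm_lift_le (h : IsBoundedLift q A L) (w : Fin k → 𝕜) : ‖L w‖ ≤ k * ‖q‖ * ‖w‖ := by
  have h1 : RCLike.re (star w ⬝ᵥ A *ᵥ w) ≤ k * ‖q‖ * ‖w‖ * ‖L w‖ := by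
    refine (RCLike.re_le_norm _).trans ?_
    rw [← h.apply_lift]
    refine (norm_sum_le _ _).trans ?_
    refine (Finset.sum_le_card_nsmul _ _ (‖w‖ * (‖q‖ * ‖L w‖)) fun i _ => ?_).trans ?_
    · rw [norm_mul, Pi.star_apply, norm_star]
      exact mul_le_mul (norm_le_pi_norm w i) ((norm_le_pi_norm _ i).trans (q.le_opNorm _))
        (norm_nonneg _) (norm_nonneg _)
    · rw [Finset.card_univ, Fintype.card_fin, nsmul_eq_mul]
      exact le_of_eq (by ring)
  by_contra! hlt
  have hpos : 0 < ‖L w‖ := lt_of_le_of_lt (by positivity) hlt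
  nlinarith [h.norm_sq_le w]

theorem norm_det_le (h : IsBoundedLift q A L) :
    ‖A.det‖ ≤ k.factorial * (‖q‖ * (k * ‖q‖)) ^ k := by
  have hA : ∀ i j, ‖A i j‖ ≤ ‖q‖ * (k * ‖q‖) := fun i j => by
    have h1 : A i j = q (L (Pi.single j 1)) i := by
      rw [h.apply_lift]
      simp
    rw [h1]
    refine (norm_le_pi_norm _ i).trans ((q.le_opNorm _).trans ?_)
    refine mul_le_mul_of_nonneg_left ((h.norm_lift_le _).trans (le_of_eq ?_)) (norm_nonneg _)
    rw [Pi.norm_single, norm_one, mul_one]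
  have := Matrix.det_le (abv := NormedField.toAbsoluteValue 𝕜) hA
  rw [Fintype.card_fin, nsmul_eq_mul] at this
  exact this

/-- Adding a rank-one term supported at the image of a vector of the unit ball and rescaling. -/
theorem add_rankOne (h : IsBoundedLift q A L) {x : E} (hx : ‖x‖ ≤ 1) {t : ℝ} (ht : 0 ≤ t) :
    ∃ L', IsBoundedLift q
      ((((1 + t)⁻¹ : ℝ) : 𝕜) • (A + Matrix.vecMulVec (q x) ((t : 𝕜) • star (q x)))) L' := by
  let d : (Fin k → 𝕜) →ₗ[𝕜] 𝕜 :=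
    { toFun := fun w => star (q x) ⬝ᵥ w
      map_add' := fun v w => dotProduct_add _ v w
      map_smul' := fun c w => dotProduct_smul c _ w }
  have hd : ∀ w, (A + Matrix.vecMulVec (q x) ((t : 𝕜) • star (q x))) *ᵥ w =
      A *ᵥ w + ((t : 𝕜) * d w) • q x := fun w => by
    rw [Matrix.add_mulVec, Matrix.vecMulVec_mulVec, smul_dotProduct, op_smul_eq_smul]
    rfl
  refine ⟨(((1 + t)⁻¹ : ℝ) : 𝕜) • (L + (t : 𝕜) • d.smulRight x), fun w => ?_, fun w => ?_⟩
  · rw [Matrix.smul_mulVec, hd, LinearMap.smul_apply, map_smul, LinearMap.add_apply, map_add,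
      h.apply_lift, LinearMap.smul_apply, LinearMap.smulRight_apply, map_smul, map_smul, smul_smul]
  · have h1 : star w ⬝ᵥ q x = star (d w) := by rw [Matrix.star_dotProduct]; rfl
    have h2 : RCLike.re (star w ⬝ᵥ ((t : 𝕜) * d w) • q x) = t * ‖d w‖ ^ 2 := by
      rw [dotProduct_smul, h1, smul_eq_mul, mul_assoc, RCLike.re_ofReal_mul, RCLike.star_def,
        RCLike.mul_conj]
      norm_cast
    have h3 : ‖L w + (t : 𝕜) • d.smulRight x w‖ ≤ ‖L w‖ + t * ‖d w‖ := by
      refine (norm_add_le _ _).trans (add_le_add_right ?_ _)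
      rw [LinearMap.smulRight_apply, norm_smul, norm_smul, RCLike.norm_ofReal, abs_of_nonneg ht]
      exact mul_le_mul_of_nonneg_left (mul_le_of_le_one_right (norm_nonneg _) hx) ht
    rw [Matrix.smul_mulVec, hd, dotProduct_smul, smul_eq_mul, RCLike.re_ofReal_mul,
      dotProduct_add, map_add, h2, LinearMap.smul_apply, norm_smul, RCLike.norm_ofReal,
      abs_of_nonneg (by positivity), LinearMap.add_apply, LinearMap.smul_apply]
    have h4 := h.norm_sq_le w
    -- Convexity of the square with weights `1/(1+t)` and `t/(1+t)`.
    have h5 : (‖L w‖ + t * ‖d w‖) ^ 2 ≤ (1 + t) * (‖L w‖ ^ 2 + t * ‖d w‖ ^ 2) := by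
      nlinarith [mul_nonneg ht (sq_nonneg (‖L w‖ - ‖d w‖))]
    calc ((1 + t)⁻¹ * ‖L w + (t : 𝕜) • d.smulRight x w‖) ^ 2
        ≤ ((1 + t)⁻¹ * (‖L w‖ + t * ‖d w‖)) ^ 2 := by gcongr
      _ = (1 + t)⁻¹ * ((1 + t)⁻¹ * (‖L w‖ + t * ‖d w‖) ^ 2) := by ring
      _ ≤ (1 + t)⁻¹ * ((1 + t)⁻¹ * ((1 + t) * (‖L w‖ ^ 2 + t * ‖d w‖ ^ 2))) := by gcongr
      _ = (1 + t)⁻¹ * (‖L w‖ ^ 2 + t * ‖d w‖ ^ 2) := by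
        rw [inv_mul_cancel_left₀ (by positivity)]
      _ ≤ _ := by gcongr

theorem exists_of_surjective (hq : Function.Surjective q) :
    ∃ A L, IsBoundedLift q A L ∧ A.det ≠ 0 := by
  obtain ⟨R, hR⟩ := (q : E →ₗ[𝕜] (Fin k → 𝕜)).exists_rightInverse_of_surjective
    (LinearMap.range_eq_top.mpr hq)
  have hR' : ∀ w, q (R w) = w := fun w => LinearMap.congr_fun hR w
  set C := ‖R.toContinuousLinearMap‖
  have hC : ∀ w, ‖R w‖ ≤ C * ‖w‖ := R.toContinuousLinearMap.le_opNorm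
  -- Scaling a right inverse by `c` with `c C² ≤ 1` gives `‖c R w‖² ≤ c ‖w‖²`.
  set c : ℝ := 1 / (C ^ 2 + 1)
  have hc : 0 < c := by positivity
  have hcC : c * C ^ 2 ≤ 1 := by
    rw [div_mul_eq_mul_div, div_le_one (by positivity)]
    linarith
  refine ⟨(c : 𝕜) • 1, (c : 𝕜) • R, ⟨fun w => ?_, fun w => ?_⟩, ?_⟩
  · simp [hR', Matrix.smul_mulVec]
  · have h1 : ‖w‖ ^ 2 ≤ RCLike.re (star w ⬝ᵥ w) := by
      have hre : RCLike.re (star w ⬝ᵥ w) = ∑ i, ‖w i‖ ^ 2 := by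
        rw [dotProduct, map_sum]
        refine Finset.sum_congr rfl fun i _ => ?_
        rw [Pi.star_apply, RCLike.star_def, RCLike.conj_mul]
        norm_cast
      have hnn : 0 ≤ ∑ i, ‖w i‖ ^ 2 := Finset.sum_nonneg fun i _ => by positivity
      rw [hre, ← Real.le_sqrt (norm_nonneg _) hnn]
      refine (pi_norm_le_iff_of_nonneg (Real.sqrt_nonneg _)).mpr fun i =>
        Real.le_sqrt_of_sq_le ?_
      exact Finset.single_le_sum (f := fun i => ‖w i‖ ^ 2) (fun i _ => by positivity)
        (Finset.mem_univ i)
    rw [Matrix.smul_mulVec, Matrix.one_mulVec, dotProduct_smul, smul_eq_mul,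
      RCLike.re_ofReal_mul, LinearMap.smul_apply, norm_smul, RCLike.norm_ofReal, abs_of_pos hc]
    have h2 : ‖R w‖ ^ 2 ≤ C ^ 2 * ‖w‖ ^ 2 := by
      rw [← mul_pow]
      exact pow_le_pow_left₀ (norm_nonneg _) (hC w) 2
    calc (c * ‖R w‖) ^ 2 = c * (c * ‖R w‖ ^ 2) := by ring
      _ ≤ c * (c * (C ^ 2 * ‖w‖ ^ 2)) := by gcongr
      _ = c * ((c * C ^ 2) * ‖w‖ ^ 2) := by ring
      _ ≤ c * (1 * ‖w‖ ^ 2) := by gcongr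
      _ ≤ _ := by rw [one_mul]; gcongr
  · rw [Matrix.det_smul, Matrix.det_one, mul_one]
    exact pow_ne_zero _ (by exact_mod_cast hc.ne')

end IsBoundedLift

theorem exists_isBoundedLift_re_le (q : E →L[𝕜] (Fin k → 𝕜)) (hq : Function.Surjective q) :
    ∃ A L, IsBoundedLift q A L ∧ IsUnit A.det ∧
      ∀ x, ‖x‖ ≤ 1 → RCLike.re (star (q x) ⬝ᵥ A⁻¹ *ᵥ q x) ≤ k + 1 := by
  set S : Set ℝ := {d | ∃ A L, IsBoundedLift q A L ∧ d = ‖A.det‖}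
  have hbdd : BddAbove S := ⟨_, by rintro _ ⟨A, L, h, rfl⟩; exact h.norm_det_le⟩
  obtain ⟨A₀, L₀, h₀, hA₀⟩ := IsBoundedLift.exists_of_surjective hq
  have hpos : 0 < sSup S :=
    (norm_pos_iff.mpr hA₀).trans_le (le_csSup hbdd ⟨A₀, L₀, h₀, rfl⟩)
  obtain ⟨t, ht⟩ : ∃ t : ℝ, t = 1 / ((k : ℝ) + 1) ^ 2 := ⟨_, rfl⟩
  have htpos : 0 < t := by rw [ht]; positivity
  have hlt := one_add_pow_lt ht
  have hmul : sSup S * ((1 + t) ^ k / (1 + (k + 1) * t)) < sSup S :=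
    mul_lt_of_lt_one_right hpos ((div_lt_one (by positivity)).mpr hlt)
  -- `A` is so close to optimal that gaining the factor `(1 + (k+1)t) / (1+t)^k` would exceed the
  -- supremum.
  obtain ⟨_, ⟨A, L, h, rfl⟩, hA⟩ := exists_lt_of_lt_csSup
    (show S.Nonempty from ⟨_, A₀, L₀, h₀, rfl⟩) hmul
  have hdet : 0 < ‖A.det‖ := lt_of_le_of_lt (by positivity) hA
  have hunit : IsUnit A.det := (norm_pos_iff.mp hdet).isUnit
  refine ⟨A, L, h, hunit, fun x hx => ?_⟩
  by_contra! hgt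
  obtain ⟨L', h'⟩ := h.add_rankOne hx htpos.le
  have hle := le_csSup hbdd ⟨_, L', h', rfl⟩
  have hnorm : 1 + (k + 1) * t ≤ ‖1 + ((t : 𝕜) • star (q x)) ⬝ᵥ A⁻¹ *ᵥ q x‖ := by
    refine le_trans ?_ (RCLike.re_le_norm _)
    rw [smul_dotProduct, smul_eq_mul, map_add, RCLike.one_re, RCLike.re_ofReal_mul]
    nlinarith
  have hdet' : ‖(((((1 + t)⁻¹ : ℝ) : 𝕜) •
      (A + Matrix.vecMulVec (q x) ((t : 𝕜) • star (q x)))).det)‖ =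
      ((1 + t) ^ k)⁻¹ * (‖A.det‖ * ‖1 + ((t : 𝕜) • star (q x)) ⬝ᵥ A⁻¹ *ᵥ q x‖) := by
    rw [Matrix.det_smul, det_add_vecMulVec hunit, norm_mul, norm_mul, Fintype.card_fin,
      norm_pow, RCLike.norm_ofReal, abs_of_nonneg (by positivity), inv_pow]
  rw [hdet'] at hle
  rw [mul_div_assoc', div_lt_iff₀ (by positivity)] at hA
  rw [inv_mul_le_iff₀ (by positivity)] at hle
  have := mul_le_mul_of_nonneg_left hnorm hdet.le
  linarith

/-- A weak form of the Kadec–Snobar theorem for the kernel of a surjection onto a `k`-dimensional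
space: there is a lift of the surjection of norm at most `√(k + 1)`. -/
theorem exists_lift_norm_le (q : E →L[𝕜] (Fin k → 𝕜)) (hq : Function.Surjective q) :
    ∃ S : (Fin k → 𝕜) →ₗ[𝕜] E, (∀ z, q (S z) = z) ∧
      ∀ x, ‖x‖ ≤ 1 → ‖S (q x)‖ ≤ Real.sqrt (k + 1) := by
  obtain ⟨A, L, h, hA, hle⟩ := exists_isBoundedLift_re_le q hq
  have hinv : ∀ z, A *ᵥ (A⁻¹ *ᵥ z) = z := fun z => by
    rw [Matrix.mulVec_mulVec, Matrix.mul_nonsing_inv _ hA, Matrix.one_mulVec]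
  refine ⟨L ∘ₗ A⁻¹.mulVecLin, fun z => ?_, fun x hx => ?_⟩
  · exact (h.apply_lift _).trans (hinv z)
  · refine Real.le_sqrt_of_sq_le ((h.norm_sq_le (A⁻¹ *ᵥ q x)).trans (le_trans ?_ (hle x hx)))
    rw [hinv]
    refine le_of_eq ?_
    rw [← RCLike.conj_re, ← RCLike.star_def, Matrix.star_dotProduct, star_star]

end Projection

/-! ### Comparison of Kolmogorov and Gelfand numbers of operators. -/

namespace HomPoly

variable {𝕜 : Type*} [RCLike 𝕜] {X Y Z : Type*}
  [NormedAddCommGroup X] [NormedSpace 𝕜 X] [NormedAddCommGroup Y] [NormedSpace 𝕜 Y]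
  [NormedAddCommGroup Z] [NormedSpace 𝕜 Z]

/-- On `ker Q` the error `J T - Q` equals `J T`, and `J` is isometric. -/
theorem norm_le_of_ker_approx (T : X →L[𝕜] Y)
    (Q : X →L[𝕜] lp (fun _ : closedBall (0 : StrongDual 𝕜 Y) 1 => 𝕜) ∞) {x : X} (hx : Q x = 0) :
    ‖T x‖ ≤
      ‖postcomp (metricInjection 𝕜 Y).toContinuousLinearMap (ofCLM T) - ofCLM Q‖ * ‖x‖ := by
  set J := (metricInjection 𝕜 Y).toContinuousLinearMap
  have hDr : ‖J.comp T - Q‖ ≤ ‖postcomp J (ofCLM T) - ofCLM Q‖ :=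
    ContinuousLinearMap.opNorm_le_of_unit_norm (norm_nonneg _) fun y hy =>
      norm_apply_le (postcomp J (ofCLM T) - ofCLM Q) hy.le
  have hDx : (J.comp T - Q) x = metricInjection 𝕜 Y (T x) := by
    rw [_root_.sub_apply, hx, sub_zero]
    rfl
  rw [← (metricInjection 𝕜 Y).norm_map (T x), ← hDx]
  exact (J.comp T - Q).le_of_opNorm_le hDr x

/-- An operator bounded by `r` on the kernel of an operator of rank less than `n` has `n`-th
Kolmogorov number at most `2 √n r`. -/
theorem kolmogorovNumber_ofCLM_le_of_ker {n : ℕ} (T : X →L[𝕜] Y) (Q : X →L[𝕜] Z)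
    (hQ : Module.rank 𝕜 (LinearMap.range Q.toLinearMap) < (n : Cardinal)) {r : ℝ} (hr : 0 ≤ r)
    (hker : ∀ x, Q x = 0 → ‖T x‖ ≤ r * ‖x‖) :
    (ofCLM T).kolmogorovNumber n ≤ 2 * Real.sqrt n * r := by
  obtain ⟨hfin, hlt⟩ := rank_lt_natCast_iff.mp hQ
  have hsn : 1 ≤ Real.sqrt n := Real.one_le_sqrt.mpr (by exact_mod_cast (by omega : 1 ≤ n))
  obtain ⟨k, hk⟩ : ∃ k, k = Module.finrank 𝕜 (LinearMap.range Q.toLinearMap) := ⟨_, rfl⟩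
  rw [← hk] at hlt
  let e : LinearMap.range Q.toLinearMap ≃L[𝕜] (Fin k → 𝕜) :=
    ContinuousLinearEquiv.ofFinrankEq (by rw [← hk, Module.finrank_fin_fun])
  let q : X →L[𝕜] (Fin k → 𝕜) := (e : _ →L[𝕜] _).comp (Q.codRestrict (LinearMap.range Q.toLinearMap) fun x => ⟨x, rfl⟩)
  have hq : Function.Surjective q := e.surjective.comp (by rintro ⟨_, x, rfl⟩; exact ⟨x, rfl⟩)
  have hqQ : ∀ x, q x = 0 → Q x = 0 := fun x hx =>
    congrArg Subtype.val ((map_eq_zero_iff e e.injective).mp hx)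
  obtain ⟨S, hS, hSn⟩ := exists_lift_norm_le q hq
  refine kolmogorovNumber_le (by positivity)
    (rank_range_lt_of_ker_le LinearMap.id ((T : X →ₗ[𝕜] Y) ∘ₗ S)
      (fun z hz => by rw [show z = 0 from hz, map_zero]) (by rwa [Module.finrank_fin_fun])) fun x hx => ?_
  refine ⟨_, ⟨q x, rfl⟩, ?_⟩
  have h1 : ofCLM T x - ((T : X →ₗ[𝕜] Y) ∘ₗ S) (q x) = T (x - S (q x)) := by
    simp
  rw [h1]
  refine (hker _ (hqQ _ (by rw [map_sub, hS, sub_self]))).trans ?_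
  -- The strict inequality `k < n` absorbs the `+ 1`; then `1 + √n ≤ 2√n`.
  have h2 : Real.sqrt (k + 1) ≤ Real.sqrt n := Real.sqrt_le_sqrt (by exact_mod_cast hlt)
  have h3 : ‖x - S (q x)‖ ≤ 2 * Real.sqrt n := by
    linarith [norm_sub_le x (S (q x)), hSn x hx]
  rw [mul_comm]
  exact mul_le_mul_of_nonneg_right h3 hr

theorem kolmogorovNumber_ofCLM_le {n : ℕ} (hn : 1 ≤ n) (T : X →L[𝕜] Y) :
    (ofCLM T).kolmogorovNumber n ≤ 2 * Real.sqrt n * (ofCLM T).gelfandNumber n := by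
  have hc : 0 < 2 * Real.sqrt n := by positivity
  rw [← div_le_iff₀' hc]
  refine le_approxNumber hn fun Q hQ => ?_
  rw [div_le_iff₀' hc]
  obtain ⟨Q, rfl⟩ := exists_eq_ofCLM Q
  rw [rank_ofCLM] at hQ
  exact kolmogorovNumber_ofCLM_le_of_ker T Q hQ (norm_nonneg _) fun x => norm_le_of_ker_approx T Q

end HomPoly
end PolySNum

theorem theorem4p11 {𝕜 : Type*} [RCLike 𝕜] {X Y : Type*}
    [NormedAddCommGroup X] [NormedSpace 𝕜 X] [CompleteSpace X]
    [NormedAddCommGroup Y] [NormedSpace 𝕜 Y] [CompleteSpace Y]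
    {m : ℕ} (hm : 2 ≤ m) (P : PolySNum.HomPoly 𝕜 m X Y) (n : ℕ) (hn : 1 ≤ n) :
    (PolySNum.HomPoly.ofCLM P.adjoint).gelfandNumber n ≤ P.kolmogorovNumber n ∧
    P.gelfandNumber n = (PolySNum.HomPoly.ofCLM P.adjoint).kolmogorovNumber n ∧
    P.gelfandNumber n ≤
      2 * Real.sqrt (n : ℝ) * (PolySNum.HomPoly.ofCLM P.adjoint).gelfandNumber n := by
  exact ⟨P.gelfandNumber_adjoint_le hn,
    le_antisymm (P.gelfandNumber_le_kolmogorovNumber_adjoint hn)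
      (P.kolmogorovNumber_adjoint_le_gelfandNumber hn),
    (P.gelfandNumber_le_kolmogorovNumber_adjoint hn).trans
      (PolySNum.HomPoly.kolmogorovNumber_ofCLM_le hn P.adjoint)⟩
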